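/- Let $G=(V,E)$ be a finite simple graph. For $\lambda>0$, let $X$ be a random independent set of $G$ drawn from the hard-core model at fugacity $\lambda$, i.e. $\Pr_{G,\lambda}(X=I)=\lambda^{|I|}/\sum_J\lambda^{|J|}$ for each independent set $I$ of $G$, where $J$ runs over all independent sets of $G$, and let $\mathbb E_{G,\lambda}$ be the expectation in this model. Write $d_u$ for the degree and $N(u)$ for the neighbourhood of a vertex $u$, $\Delta$ for the maximum degree, and $\operatorname{mad}(H)=\max_{F\subseteq H,\ |V(F)|>0}2|E(F)|/|V(F)|$ for the maximum average degree of a graph $H$. Let $W\colon(0,\infty)\to(0,\infty)$ be the Lambert function, the inverse of $x\mapsto xe^x$ on $(0,\infty)$. For every $b\in\{0\}\cup[1,\infty)$ there is a constant $c=c(b)\in(0,1)$, depending only on $b$, such that the following holds. Let $G$ be a graph of maximum degree $\Delta$ with no isolated vertices such that $\operatorname{mad}(G[N(u)])\le b$ for every $u\in V$. Let $0<\lambda<c/\Delta$, and for $u\in V$ put $$D_u=d_u(1+\lambda)^b\log(1+\lambda),\qquad \beta_u=\frac{1+\lambda}{\lambda}\,\frac{D_u}{W(D_u)(1+W(D_u))},\qquad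 \gamma_u=\frac{1+\lambda}{\lambda}\,\frac{D_u}{d_u(1+W(D_u))}.$$ Then $$\mathbb E_{G,\lambda}|X|\ \ge\ \sum_{u\in V}\frac{1}{\beta_u+d_u\gamma_u}.$$ In particular, one can choose $c(0)=0.109597$ and $c(b)=0.0896883/b$ for $b\ge1$. -/

import Mathlib

noncomputable section

/-! ### The hard-core model on a finite graph -/

namespace SimpleGraph

section HardCore

variable {V : Type*} [Fintype V]

open Classical in
/-- The finite set of all independent sets of `G`. -/
def indepSets (G : SimpleGraph V) : Finset (Finset V) :=
  Finset.univ.filter fun I => G.IsIndepSet (I : Set V)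

/-- The partition function `∑_J ∏_{v ∈ J} lam v`, over the independent sets `J` of `G`. -/
def partitionFunction (G : SimpleGraph V) (lam : V → ℝ) : ℝ :=
  ∑ J ∈ G.indepSets, ∏ v ∈ J, lam v

/-- The probability of the independent set `I` in the hard-core model at fugacity `lam`. -/
def hardCorePr (G : SimpleGraph V) (lam : V → ℝ) (I : Finset V) : ℝ :=
  (∏ v ∈ I, lam v) / G.partitionFunction lam

/-- The expectation of `f X`, for `X` a random independent set of `G` drawn from the hard-core
model at fugacity `lam`. -/
def hardCoreExpectation (G : SimpleGraph V) (lam : V → ℝ) (f : Finset V → ℝ) : ℝ :=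
  ∑ I ∈ G.indepSets, G.hardCorePr lam I * f I

end HardCore

/-! ### Maximum average degree -/

/-- The maximum average degree of a finite nonempty graph `H`: the maximum of
`2|E(F)| / |V(F)|` over the subgraphs `F` of `H` with at least one vertex.
The set of values is finite and nonempty, so that the supremum is a maximum. -/
def maxAverageDegree {V : Type*} (H : SimpleGraph V) : ℝ :=
  sSup {r : ℝ | ∃ F : H.Subgraph, F.verts.Nonempty ∧
    r = 2 * (F.edgeSet.ncard : ℝ) / (F.verts.ncard : ℝ)}

end SimpleGraph

/-! ### The Lambert function on the positive half-line -/

/-- The Lambert `W`-function on `(0, ∞)`: for `x > 0` it is the unique `w > 0` with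
`w * exp w = x`. -/
def lambertW (x : ℝ) : ℝ :=
  Function.invFunOn (fun w : ℝ => w * Real.exp w) (Set.Ioi 0) x

theorem lambertW_spec {x : ℝ} (hx : 0 < x) :
    0 < lambertW x ∧ lambertW x * Real.exp (lambertW x) = x := by
  have h : ∃ w ∈ Set.Ioi (0 : ℝ), w * Real.exp w = x := by
    have hc : ContinuousOn (fun w : ℝ => w * Real.exp w) (Set.Icc 0 x) := by fun_prop
    have hmem : x ∈ Set.Icc ((0 : ℝ) * Real.exp 0) (x * Real.exp x) := by
      refine ⟨by simpa using hx.le, ?_⟩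
      nlinarith [Real.one_le_exp hx.le]
    obtain ⟨w, hw, hwx⟩ := intermediate_value_Icc hx.le hc hmem
    refine ⟨w, lt_of_le_of_ne hw.1 ?_, hwx⟩
    rintro rfl
    simp at hwx
    exact hx.ne hwx
  exact ⟨Function.invFunOn_mem h, Function.invFunOn_eq h⟩

/-! ### The parameters of the bound -/

/-- `D = d (1 + lam)^b log (1 + lam)`, for a vertex of degree `d`. -/
def occD (b lam : ℝ) (d : ℕ) : ℝ :=
  d * (1 + lam) ^ b * Real.log (1 + lam)

/-- `β = ((1 + lam) / lam) * D / (W(D) (1 + W(D)))`. -/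
def occBeta (b lam : ℝ) (d : ℕ) : ℝ :=
  (1 + lam) / lam *
    (occD b lam d / (lambertW (occD b lam d) * (1 + lambertW (occD b lam d))))

/-- `γ = ((1 + lam) / lam) * D / (d (1 + W(D)))`. -/
def occGamma (b lam : ℝ) (d : ℕ) : ℝ :=
  (1 + lam) / lam * (occD b lam d / (d * (1 + lambertW (occD b lam d))))

end

/-! Since `β_u + d_u γ_u = ((1+λ)/λ) e^{W_u}` with `W_u = W(D_u)`, the target is `∑ x_u ≥ ∑
e^{-W_u}` for `x_u = ((1+λ)/λ) Pr(u ∈ X)`.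

Conditioning on `X` outside `N(u)` gives a local inequality `e^{W_u} x_u + ∑_v a_{uv} x_v ≥ 1 +
W_u`, where `a` is the adjacency matrix scaled by `(1+λ)^b log(1+λ)`, so that row `u` sums to `D_u =
W_u e^{W_u}` (`local_occupancy`).

The rest is linear programming duality (`sum_exp_neg_le_sum`). With `S = diag(e^W) + a`, symmetric,
solve `S z = 1`. The fugacity bound makes all `D_u ≤ 1/8`, so `S` is diagonally dominant and `z ≥
0`; hence `∑ x_u ≥ ∑ z_u (1 + W_u)`. For constant `W` the solution is `q = e^{-W}/(1+W)` and the
bound is attained. In general the defect is expressed through the Laplacian of `a`: a Dirichlet form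
gains at least `Q/2`, where `Q = ∑ a_{uv} (e^{-W_u} - e^{-W_v})^2`, and the error from `z ≠ q` costs
at most `Q/2`. -/

/-! ### Diagonally dominant systems and one-variable estimates -/

open Finset in
theorem exists_nonneg_solution {V : Type*} [Fintype V] (a : V → V → ℝ)
    (ha : ∀ u v, 0 ≤ a u v) (k : V → ℝ) (hk : ∀ u, 1 ≤ k u) (hsum : ∀ u, ∑ v, a u v ≤ 1 / 8) :
    ∃ z : V → ℝ, (∀ u, 0 ≤ z u) ∧ ∀ u, k u * z u + ∑ v, a u v * z v = 1 := by
  classical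
  have hbound : ∀ (z : V → ℝ) {M : ℝ}, (∀ v, |z v| ≤ M) →
      ∀ w, |∑ v, a w v * z v| ≤ 1 / 8 * M := by
    intro z M hM w
    calc |∑ v, a w v * z v| ≤ ∑ v, |a w v * z v| := abs_sum_le_sum_abs _ _
      _ ≤ ∑ v, a w v * M := sum_le_sum fun v _ => by
          rw [abs_mul, abs_of_nonneg (ha w v)]
          exact mul_le_mul_of_nonneg_left (hM v) (ha w v)
      _ = (∑ v, a w v) * M := by rw [sum_mul]
      _ ≤ _ := mul_le_mul_of_nonneg_right (hsum w) ((abs_nonneg _).trans (hM w))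
  have hdiag : ∀ (z : V → ℝ) u, |z u| ≤ |k u * z u| := by
    intro z u
    rw [abs_mul]
    exact le_mul_of_one_le_left (abs_nonneg _) ((hk u).trans (le_abs_self _))
  obtain ⟨z, hz⟩ : ∃ z : V → ℝ, ∀ u, k u * z u + ∑ v, a u v * z v = 1 := by
    let f : (V → ℝ) →ₗ[ℝ] (V → ℝ) := Matrix.toLin' (Matrix.diagonal k + Matrix.of a)
    have hf : ∀ z u, f z u = k u * z u + ∑ v, a u v * z v := by
      intro z u
      have h : f z = (Matrix.diagonal k).mulVec z + (Matrix.of a).mulVec z := by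
        simp [f]
      rw [h, Pi.add_apply, Matrix.mulVec_diagonal]
      rfl
    have hinj : Function.Injective f := by
      rw [injective_iff_map_eq_zero]
      intro z hz
      by_contra hne
      obtain ⟨u₀, hu₀⟩ := Function.ne_iff.mp hne
      obtain ⟨u, -, hu⟩ := exists_max_image univ (fun u => |z u|) ⟨u₀, mem_univ _⟩
      have h1 : k u * z u = -∑ v, a u v * z v := by
        have := congrFun hz u
        rw [hf] at this
        simp only [Pi.zero_apply] at this
        linarith
      have h2 := hbound z (fun v => hu v (mem_univ _)) u
      have h3 := hdiag z u
      rw [h1, abs_neg] at h3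
      have h4 : 0 < |z u| := lt_of_lt_of_le (abs_pos.mpr hu₀) (hu u₀ (mem_univ _))
      linarith
    obtain ⟨z, hz⟩ := (LinearMap.injective_iff_surjective.mp hinj) (fun _ => 1)
    exact ⟨z, fun u => by rw [← hf, hz]⟩
  refine ⟨z, fun w => ?_, hz⟩
  obtain ⟨u, -, hu⟩ := exists_max_image univ (fun u => |z u|) ⟨w, mem_univ _⟩
  have h2 := hbound z (fun v => hu v (mem_univ _))
  have h3 := hdiag z u
  -- At the maximum this gives `|z u| ≤ 8/7`, so every off-diagonal sum is at most `1/7 < 1` and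
  -- each `k w * z w` is positive.
  have h4 : |k u * z u| ≤ 1 + 1 / 8 * |z u| := by
    have h5 := abs_le.mp (h2 u)
    have h6 := hz u
    rw [abs_le]
    constructor <;> linarith [abs_nonneg (z u), h5.1, h5.2]
  have h5 := (abs_le.mp (h2 w)).2
  have h6 := hz w
  by_contra hneg
  nlinarith [hk w]

/-- The difference of the two functions is `e^{-s} s/(1+s)`, which increases for small `s`; tangent
lines of `exp` replace derivatives. -/
theorem exp_neg_sub_le {s t : ℝ} (hs : 0 ≤ s) (hst : s ≤ t) (ht : t ≤ 1 / 8) :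
    Real.exp (-s) - Real.exp (-t) ≤ Real.exp (-s) / (1 + s) - Real.exp (-t) / (1 + t) := by
  have h1 : Real.exp (-s) * (1 - (t - s)) ≤ Real.exp (-t) := by
    have := Real.add_one_le_exp (-(t - s))
    calc Real.exp (-s) * (1 - (t - s)) ≤ Real.exp (-s) * Real.exp (-(t - s)) := by
          gcongr; linarith
      _ = _ := by rw [← Real.exp_add]; ring_nf
  have h1' : Real.exp (-t) * (1 + (t - s)) ≤ Real.exp (-s) := by
    have := Real.add_one_le_exp (t - s)
    calc Real.exp (-t) * (1 + (t - s)) ≤ Real.exp (-t) * Real.exp (t - s) := by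
          gcongr; linarith
      _ = _ := by rw [← Real.exp_add]; ring_nf
  have h2 : Real.exp (-s) * (s / (1 + s)) ≤ Real.exp (-t) * (t / (1 + t)) := by
    have h3 : s / (1 + s) ≤ (1 - (t - s)) * (t / (1 + t)) := by
      rw [← mul_div_assoc, div_le_div_iff₀ (by linarith) (by linarith)]
      nlinarith [mul_nonneg (sub_nonneg.mpr hst) (show 0 ≤ 1 - t * (1 + s) by nlinarith)]
    calc Real.exp (-s) * (s / (1 + s)) ≤ Real.exp (-s) * ((1 - (t - s)) * (t / (1 + t))) := by
          gcongr
      _ = Real.exp (-s) * (1 - (t - s)) * (t / (1 + t)) := by ring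
      _ ≤ _ := by
          have : 0 ≤ t / (1 + t) := div_nonneg (by linarith) (by linarith)
          gcongr
  have e1 : Real.exp (-s) * (s / (1 + s)) = Real.exp (-s) - Real.exp (-s) / (1 + s) := by
    have : 1 + s ≠ 0 := by linarith
    field_simp; ring
  have e2 : Real.exp (-t) * (t / (1 + t)) = Real.exp (-t) - Real.exp (-t) / (1 + t) := by
    have : 1 + t ≠ 0 := by linarith
    field_simp; ring
  linarith

/-- Equivalent to `e^{-s}(1+2s)/(1+s)` being decreasing on `s ≥ 0`. -/
theorem le_two_mul_exp_neg_sub {s t : ℝ} (hs : 0 ≤ s) (hst : s ≤ t) :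
    Real.exp (-s) / (1 + s) - Real.exp (-t) / (1 + t) ≤ 2 * (Real.exp (-s) - Real.exp (-t)) := by
  have h1 : Real.exp (-t) * (1 + (t - s)) ≤ Real.exp (-s) := by
    have := Real.add_one_le_exp (t - s)
    calc Real.exp (-t) * (1 + (t - s)) ≤ Real.exp (-t) * Real.exp (t - s) := by
          gcongr; linarith
      _ = _ := by rw [← Real.exp_add]; ring_nf
  have h2 : Real.exp (-t) * ((1 + 2 * t) / (1 + t)) ≤ Real.exp (-s) * ((1 + 2 * s) / (1 + s)) := by
    have h3 : (1 + 2 * t) / (1 + t) ≤ (1 + (t - s)) * ((1 + 2 * s) / (1 + s)) := by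
      rw [← mul_div_assoc, div_le_div_iff₀ (by linarith) (by linarith)]
      nlinarith [mul_nonneg (sub_nonneg.mpr hst) (show 0 ≤ (1 + 2 * s) * (1 + t) - 1 by nlinarith)]
    calc _ ≤ Real.exp (-t) * ((1 + (t - s)) * ((1 + 2 * s) / (1 + s))) := by gcongr
      _ = Real.exp (-t) * (1 + (t - s)) * ((1 + 2 * s) / (1 + s)) := by ring
      _ ≤ _ := by gcongr
  have e1 : Real.exp (-s) * ((1 + 2 * s) / (1 + s))
      = 2 * Real.exp (-s) - Real.exp (-s) / (1 + s) := by
    have : 1 + s ≠ 0 := by linarith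
    field_simp; ring
  have e2 : Real.exp (-t) * ((1 + 2 * t) / (1 + t))
      = 2 * Real.exp (-t) - Real.exp (-t) / (1 + t) := by
    have : 1 + t ≠ 0 := by linarith
    field_simp; ring
  linarith

/-! ### Weighted Laplacians and the duality argument -/

/-- The Laplacian of a weighted graph, applied to the function `f`. -/
def weightedLaplacian {V : Type*} [Fintype V] (a : V → V → ℝ) (f : V → ℝ) (u : V) : ℝ :=
  ∑ v, a u v * (f u - f v)

section Laplacian

open Finset

variable {V : Type*} [Fintype V] {a : V → V → ℝ}

/-- Green's identity: swap the endpoints and average. The sum on the right counts each edge twice.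
-/
theorem sum_mul_weightedLaplacian (hsymm : ∀ u v, a u v = a v u) (f g : V → ℝ) :
    ∑ u, f u * weightedLaplacian a g u
      = (∑ u, ∑ v, a u v * ((f u - f v) * (g u - g v))) / 2 := by
  have h1 : ∑ u, f u * weightedLaplacian a g u = ∑ u, ∑ v, a u v * (f u * (g u - g v)) :=
    sum_congr rfl fun u _ => by
      rw [weightedLaplacian, mul_sum]
      exact sum_congr rfl fun v _ => by ring
  have h2 : ∑ u, f u * weightedLaplacian a g u = ∑ u, ∑ v, a u v * (f v * (g v - g u)) := by
    rw [h1, sum_comm]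
    exact sum_congr rfl fun u _ => sum_congr rfl fun v _ => by rw [hsymm]
  have h3 : ∑ u, ∑ v, a u v * ((f u - f v) * (g u - g v))
      = ∑ u, ∑ v, a u v * (f u * (g u - g v)) + ∑ u, ∑ v, a u v * (f v * (g v - g u)) := by
    rw [← sum_add_distrib]
    refine sum_congr rfl fun u _ => ?_
    rw [← sum_add_distrib]
    exact sum_congr rfl fun v _ => by ring
  rw [h3, ← h1, ← h2]
  ring

theorem sum_weightedLaplacian_sq_le (hnn : ∀ u v, 0 ≤ a u v) {r : ℝ}
    (hsum : ∀ u, ∑ v, a u v ≤ r) (f : V → ℝ) :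
    ∑ u, weightedLaplacian a f u ^ 2 ≤ r * ∑ u, ∑ v, a u v * (f u - f v) ^ 2 := by
  rw [mul_sum]
  refine sum_le_sum fun u _ => ?_
  calc weightedLaplacian a f u ^ 2
      ≤ (∑ v, a u v) * ∑ v, a u v * (f u - f v) ^ 2 :=
        sum_sq_le_sum_mul_sum_of_sq_le_mul _ (fun v _ => hnn u v)
          (fun v _ => mul_nonneg (hnn u v) (sq_nonneg _)) (fun v _ => le_of_eq (by ring))
    _ ≤ _ := mul_le_mul_of_nonneg_right (hsum u)
        (sum_nonneg fun v _ => mul_nonneg (hnn u v) (sq_nonneg _))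

/-- Expand the nonnegative signless form `∑ a_{uv} (e_u + e_v)^2`. -/
theorem neg_mul_sum_sq_le (hnn : ∀ u v, 0 ≤ a u v) (hsymm : ∀ u v, a u v = a v u) {r : ℝ}
    (hsum : ∀ u, ∑ v, a u v ≤ r) (e : V → ℝ) :
    -(r * ∑ u, e u ^ 2) ≤ ∑ u, e u * ∑ v, a u v * e v := by
  have h1 : ∑ u, ∑ v, a u v * e u ^ 2 ≤ r * ∑ u, e u ^ 2 := by
    rw [mul_sum]
    refine sum_le_sum fun u _ => ?_
    rw [← sum_mul]
    exact mul_le_mul_of_nonneg_right (hsum u) (sq_nonneg _)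
  have h2 : ∑ u, ∑ v, a u v * e v ^ 2 = ∑ u, ∑ v, a u v * e u ^ 2 := by
    rw [sum_comm]
    exact sum_congr rfl fun u _ => sum_congr rfl fun v _ => by rw [hsymm]
  have h3 : 0 ≤ ∑ u, ∑ v, a u v * (e u + e v) ^ 2 :=
    sum_nonneg fun u _ => sum_nonneg fun v _ => mul_nonneg (hnn u v) (sq_nonneg _)
  have h4 : ∑ u, ∑ v, a u v * (e u + e v) ^ 2
      = ∑ u, ∑ v, a u v * e u ^ 2 + ∑ u, ∑ v, a u v * e v ^ 2
        + 2 * ∑ u, e u * ∑ v, a u v * e v := by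
    simp_rw [mul_sum]
    rw [← sum_add_distrib, ← sum_add_distrib]
    refine sum_congr rfl fun u _ => ?_
    rw [← sum_add_distrib, ← sum_add_distrib]
    exact sum_congr rfl fun v _ => by ring
  linarith

/-- Pair the constraints with the dual solution `z`, then compare `z` with `q`, which would solve
the system if `W` were constant. -/
theorem sum_exp_neg_le_sum (hnn : ∀ u v, 0 ≤ a u v) (hsymm : ∀ u v, a u v = a v u)
    {W : V → ℝ} (hW : ∀ u, 0 ≤ W u) (hrow : ∀ u, ∑ v, a u v = W u * Real.exp (W u))
    (hsmall : ∀ u, ∑ v, a u v ≤ 1 / 8) {x : V → ℝ}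
    (hx : ∀ u, 1 + W u ≤ Real.exp (W u) * x u + ∑ v, a u v * x v) :
    ∑ u, Real.exp (-W u) ≤ ∑ u, x u := by
  have hW8 : ∀ u, W u ≤ 1 / 8 := fun u => by
    nlinarith [hrow u, hsmall u, hW u, Real.one_le_exp (hW u)]
  obtain ⟨z, hz0, hz⟩ := exists_nonneg_solution a hnn (fun u => Real.exp (W u))
    (fun u => Real.one_le_exp (hW u)) hsmall
  have hswap : ∀ f g : V → ℝ, ∑ u, f u * ∑ v, a u v * g v = ∑ u, g u * ∑ v, a u v * f v := by
    intro f g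
    simp_rw [mul_sum]
    rw [sum_comm]
    exact sum_congr rfl fun u _ => sum_congr rfl fun v _ => by rw [hsymm]; ring
  have hxz : ∑ u, z u * (1 + W u) ≤ ∑ u, x u := by
    calc ∑ u, z u * (1 + W u) ≤ ∑ u, z u * (Real.exp (W u) * x u + ∑ v, a u v * x v) :=
          sum_le_sum fun u _ => mul_le_mul_of_nonneg_left (hx u) (hz0 u)
      _ = ∑ u, x u * (Real.exp (W u) * z u + ∑ v, a u v * z v) := by
          simp_rw [mul_add]
          rw [sum_add_distrib, sum_add_distrib, hswap z x]
          congr 1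
          exact sum_congr rfl fun u _ => by ring
      _ = ∑ u, x u := sum_congr rfl fun u _ => by rw [hz u, mul_one]
  refine le_trans ?_ hxz
  set p : V → ℝ := fun u => Real.exp (-W u) with hp
  set q : V → ℝ := fun u => Real.exp (-W u) / (1 + W u) with hq
  set e : V → ℝ := fun u => z u - q u with he
  have hW1 : ∀ u, 1 + W u ≠ 0 := fun u => by linarith [hW u]
  have hexp : ∀ u, Real.exp (W u) * p u = 1 := fun u => by
    rw [hp, ← Real.exp_add]; simp
  have hqp : ∀ u, q u * (1 + W u) = p u := fun u => div_mul_cancel₀ _ (hW1 u)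
  have hlap : ∀ (f : V → ℝ) u,
      weightedLaplacian a f u = W u * Real.exp (W u) * f u - ∑ v, a u v * f v := by
    intro f u
    rw [weightedLaplacian, ← hrow, sum_mul, ← sum_sub_distrib]
    exact sum_congr rfl fun v _ => by ring
  have hSe : ∀ u, Real.exp (W u) * e u + ∑ v, a u v * e v = weightedLaplacian a q u := by
    intro u
    have h1 : ∑ v, a u v * e v = ∑ v, a u v * z v - ∑ v, a u v * q v := by
      rw [← sum_sub_distrib]
      exact sum_congr rfl fun v _ => by rw [he]; ring
    have h2 : Real.exp (W u) * q u * (1 + W u) = 1 := by rw [mul_assoc, hqp, hexp]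
    rw [hlap, h1]
    have := hz u
    simp only [he]
    linarith
  have hSp : ∀ u, 1 + W u = Real.exp (W u) * p u + ∑ v, a u v * p v + weightedLaplacian a p u := by
    intro u
    rw [hlap, hexp, mul_assoc, hexp]
    ring
  -- With `S = diag(e^W) + a` and Laplacian `L`: `S e = L q`, `1 + W = S p + L p` and `q (1 + W) =
  -- p`. Symmetry of `S` turns `⟨e, S p⟩` into `⟨p, L q⟩`.
  have hmain : ∑ u, z u * (1 + W u)
      = ∑ u, p u + ∑ u, p u * weightedLaplacian a q u + ∑ u, e u * weightedLaplacian a p u := by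
    have h1 : ∑ u, e u * (1 + W u)
        = ∑ u, p u * weightedLaplacian a q u + ∑ u, e u * weightedLaplacian a p u := by
      simp_rw [← hSe]
      calc ∑ u, e u * (1 + W u)
          = ∑ u, (e u * (Real.exp (W u) * p u) + e u * ∑ v, a u v * p v
              + e u * weightedLaplacian a p u) :=
            sum_congr rfl fun u _ => by rw [hSp u]; ring
        _ = _ := by
            simp_rw [mul_add]
            rw [sum_add_distrib, sum_add_distrib, sum_add_distrib, hswap e p]
            congr 2
            exact sum_congr rfl fun u _ => by ring
    rw [add_assoc, ← h1, ← sum_add_distrib]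
    exact sum_congr rfl fun u _ => by rw [← hqp u, he]; ring
  set Q : ℝ := ∑ u, ∑ v, a u v * (p u - p v) ^ 2 with hQ
  have hQ0 : 0 ≤ Q := sum_nonneg fun u _ => sum_nonneg fun v _ => mul_nonneg (hnn u v) (sq_nonneg _)
  have hedge : ∀ u v, (p u - p v) ^ 2 ≤ (p u - p v) * (q u - q v) ∧
      (q u - q v) ^ 2 ≤ 4 * (p u - p v) ^ 2 := by
    have key : ∀ u v, W u ≤ W v → (p u - p v) ^ 2 ≤ (p u - p v) * (q u - q v) ∧
        (q u - q v) ^ 2 ≤ 4 * (p u - p v) ^ 2 := by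
      intro u v huv
      have h1 : p u - p v ≤ q u - q v := exp_neg_sub_le (hW u) huv (hW8 v)
      have h2 : q u - q v ≤ 2 * (p u - p v) := le_two_mul_exp_neg_sub (hW u) huv
      have h3 : 0 ≤ p u - p v := sub_nonneg.mpr (Real.exp_le_exp.mpr (neg_le_neg huv))
      constructor <;> nlinarith
    intro u v
    rcases le_total (W u) (W v) with h | h
    · exact key u v h
    · have := key v u h
      constructor <;> nlinarith [this.1, this.2]
  have hpq : Q / 2 ≤ ∑ u, p u * weightedLaplacian a q u := by
    rw [sum_mul_weightedLaplacian hsymm]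
    have : Q ≤ ∑ u, ∑ v, a u v * ((p u - p v) * (q u - q v)) :=
      sum_le_sum fun u _ => sum_le_sum fun v _ => mul_le_mul_of_nonneg_left (hedge u v).1 (hnn u v)
    linarith
  have hLp : ∑ u, weightedLaplacian a p u ^ 2 ≤ 1 / 8 * Q :=
    sum_weightedLaplacian_sq_le hnn hsmall p
  have hLq : ∑ u, weightedLaplacian a q u ^ 2 ≤ 1 / 2 * Q := by
    refine (sum_weightedLaplacian_sq_le hnn hsmall q).trans ?_
    have : ∑ u, ∑ v, a u v * (q u - q v) ^ 2 ≤ 4 * Q := by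
      rw [hQ, mul_sum]
      refine sum_le_sum fun u _ => ?_
      rw [mul_sum]
      refine sum_le_sum fun v _ => ?_
      nlinarith [mul_le_mul_of_nonneg_left (hedge u v).2 (hnn u v)]
    linarith
  have hcoer : 7 / 8 * ∑ u, e u ^ 2 ≤ ∑ u, e u * weightedLaplacian a q u := by
    have h1 := neg_mul_sum_sq_le hnn hsymm hsmall e
    have h2 : ∑ u, e u ^ 2 ≤ ∑ u, e u * (Real.exp (W u) * e u) :=
      sum_le_sum fun u _ => by nlinarith [Real.one_le_exp (hW u), sq_nonneg (e u)]
    have h3 : ∑ u, e u * weightedLaplacian a q u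
        = ∑ u, e u * (Real.exp (W u) * e u) + ∑ u, e u * ∑ v, a u v * e v := by
      rw [← sum_add_distrib]
      exact sum_congr rfl fun u _ => by rw [← hSe]; ring
    linarith
  have hyoung : ∀ f : V → ℝ, ∀ t : ℝ, 0 < t →
      ∑ u, e u * f u ≤ t / 2 * ∑ u, e u ^ 2 + 1 / (2 * t) * ∑ u, f u ^ 2 := by
    intro f t ht
    rw [mul_sum, mul_sum, ← sum_add_distrib]
    refine sum_le_sum fun u _ => ?_
    have : 0 ≤ (t * e u - f u) ^ 2 / (2 * t) := by positivity
    have h : (t * e u - f u) ^ 2 / (2 * t)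
        = t / 2 * e u ^ 2 + 1 / (2 * t) * f u ^ 2 - e u * f u := by
      field_simp; ring
    linarith
  -- The weight `7/8` absorbs half of the coercivity bound `hcoer`.
  have he2 : ∑ u, e u ^ 2 ≤ 32 / 49 * Q := by
    have := hyoung (weightedLaplacian a q) (7 / 8) (by norm_num)
    norm_num at this
    linarith
  -- The cost is at most `(1/4)(32/49) Q + (1/8) Q < Q/2`.
  have hlast : -(Q / 2) ≤ ∑ u, e u * weightedLaplacian a p u := by
    have := hyoung (fun u => -weightedLaplacian a p u) (1 / 2) (by norm_num)
    simp only [mul_neg, sum_neg_distrib, neg_sq] at this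
    norm_num at this
    linarith
  rw [hmain]
  linarith

end Laplacian

/-! ### Local occupancy in the hard-core model -/

namespace SimpleGraph

section HardCoreRestriction

open Classical Finset

variable {V : Type*} (G : SimpleGraph V)

/-- The independent sets of `G` that are contained in `U`. -/
noncomputable def indepSetsIn (U : Finset V) : Finset (Finset V) :=
  U.powerset.filter fun I => G.IsIndepSet (I : Set V)

/-- The vertices of `S` without a neighbour in `J`. -/
noncomputable def unblocked (S J : Finset V) : Finset V :=
  S.filter fun v => ∀ w ∈ J, ¬G.Adj v w

variable {G} {U S : Finset V} {lam : ℝ}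

theorem mem_indepSetsIn {I : Finset V} :
    I ∈ G.indepSetsIn U ↔ I ⊆ U ∧ ∀ v ∈ I, ∀ w ∈ I, ¬G.Adj v w := by
  rw [indepSetsIn, mem_filter, mem_powerset]
  refine and_congr_right fun _ => ⟨fun h v hv w hw hvw => h hv hw hvw.ne hvw,
    fun h v hv w hw _ => h v hv w hw⟩

theorem unblocked_subset {J : Finset V} : G.unblocked S J ⊆ S :=
  filter_subset _ _

theorem empty_mem_indepSetsIn : ∅ ∈ G.indepSetsIn U := by
  simp [mem_indepSetsIn]

/-- Spatial Markov property: given `J = I \ S`, the part inside `S` is a hard-core set on the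
vertices that `J` leaves unblocked. -/
theorem sum_indepSetsIn_eq (hS : S ⊆ U) (f : Finset V → ℝ) :
    ∑ I ∈ G.indepSetsIn U, lam ^ #I * f (I ∩ S)
      = ∑ J ∈ G.indepSetsIn (U \ S), lam ^ #J *
          ∑ T ∈ G.indepSetsIn (G.unblocked S J), lam ^ #T * f T := by
  simp_rw [mul_sum]
  rw [sum_sigma']
  refine sum_bij' (fun I _ => ⟨I \ S, I ∩ S⟩) (fun x _ => x.1 ∪ x.2) ?_ ?_ ?_ ?_ ?_
  · intro I hI
    rw [mem_indepSetsIn] at hI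
    simp only [mem_sigma, mem_indepSetsIn, unblocked]
    refine ⟨⟨sdiff_subset_sdiff hI.1 le_rfl, ?_⟩, ?_, ?_⟩
    · exact fun v hv w hw => hI.2 v (mem_sdiff.mp hv).1 w (mem_sdiff.mp hw).1
    · exact fun v hv => mem_filter.mpr ⟨(mem_inter.mp hv).2,
        fun w hw => hI.2 v (mem_inter.mp hv).1 w (mem_sdiff.mp hw).1⟩
    · exact fun v hv w hw => hI.2 v (mem_inter.mp hv).1 w (mem_inter.mp hw).1
  · rintro ⟨J, T⟩ h
    simp only [mem_sigma, mem_indepSetsIn, unblocked] at h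
    obtain ⟨⟨hJ, hJi⟩, hT, hTi⟩ := h
    rw [mem_indepSetsIn]
    refine ⟨union_subset (hJ.trans sdiff_subset) ((hT.trans (filter_subset _ _)).trans hS), ?_⟩
    intro v hv w hw
    rcases mem_union.mp hv with hv | hv <;> rcases mem_union.mp hw with hw | hw
    · exact hJi v hv w hw
    · exact fun h => (mem_filter.mp (hT hw)).2 v hv h.symm
    · exact (mem_filter.mp (hT hv)).2 w hw
    · exact hTi v hv w hw
  · intro I _
    exact sdiff_union_inter I S
  · rintro ⟨J, T⟩ h
    simp only [mem_sigma, mem_indepSetsIn, unblocked] at h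
    obtain ⟨⟨hJ, hJi⟩, hT, hTi⟩ := h
    have hJS : ∀ v ∈ J, v ∉ S := fun v hv => (mem_sdiff.mp (hJ hv)).2
    have hTS : ∀ v ∈ T, v ∈ S := fun v hv => (mem_filter.mp (hT hv)).1
    have h1 : (J ∪ T) \ S = J := by ext v; grind
    have h2 : (J ∪ T) ∩ S = T := by ext v; grind
    simp only [h1, h2]
  · intro I _
    simp only
    rw [← mul_assoc, ← pow_add, card_sdiff_add_card_inter]

theorem sum_indepSetsIn_le (hlam : 0 < lam) :
    ∑ I ∈ G.indepSetsIn U, lam ^ #I ≤ (1 + lam) ^ #U := by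
  have h := sum_pow_mul_eq_add_pow lam 1 U
  simp only [one_pow, mul_one] at h
  rw [add_comm, ← h]
  exact sum_le_sum_of_subset_of_nonneg (filter_subset _ _) fun _ _ _ => by positivity

theorem sum_indepSetsIn_pos (hlam : 0 < lam) : 0 < ∑ I ∈ G.indepSetsIn U, lam ^ #I :=
  sum_pos (fun _ _ => by positivity) ⟨∅, empty_mem_indepSetsIn⟩

/-- When no neighbour of `v` is occupied, `v` is freely in or out, with weights `lam` and `1`. -/
theorem one_add_mul_sum_mem {v : V} (hv : v ∈ U) :
    (1 + lam) * ∑ I ∈ G.indepSetsIn U with v ∈ I, lam ^ #I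
      = lam * ∑ I ∈ G.indepSetsIn U with ∀ w ∈ I, ¬G.Adj v w, lam ^ #I := by
  have h1 : ∑ I ∈ G.indepSetsIn U with v ∈ I, lam ^ #I
      = lam * ∑ I ∈ G.indepSetsIn U with (∀ w ∈ I, ¬G.Adj v w) ∧ v ∉ I, lam ^ #I := by
    rw [mul_sum]
    refine sum_bij' (fun I _ => I.erase v) (fun I _ => insert v I) ?_ ?_ ?_ ?_ ?_
    · intro I hI
      rw [mem_filter, mem_indepSetsIn] at hI
      rw [mem_filter, mem_indepSetsIn]
      refine ⟨⟨(erase_subset _ _).trans hI.1.1, ?_⟩, ?_, notMem_erase _ _⟩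
      · exact fun x hx y hy => hI.1.2 x (mem_of_mem_erase hx) y (mem_of_mem_erase hy)
      · exact fun y hy => hI.1.2 v hI.2 y (mem_of_mem_erase hy)
    · intro I hI
      rw [mem_filter, mem_indepSetsIn] at hI
      rw [mem_filter, mem_indepSetsIn]
      refine ⟨⟨insert_subset hv hI.1.1, ?_⟩, mem_insert_self _ _⟩
      intro x hx y hy
      rcases mem_insert.mp hx with rfl | hx' <;> rcases mem_insert.mp hy with rfl | hy'
      · exact G.loopless.irrefl _
      · exact hI.2.1 y hy'
      · exact fun h => hI.2.1 x hx' h.symm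
      · exact hI.1.2 x hx' y hy'
    · exact fun I hI => insert_erase (mem_filter.mp hI).2
    · exact fun I hI => erase_insert (mem_filter.mp hI).2.2
    · intro I hI
      rw [← pow_succ', card_erase_add_one (mem_filter.mp hI).2]
  have h2 : ∑ I ∈ G.indepSetsIn U with ∀ w ∈ I, ¬G.Adj v w, lam ^ #I
      = ∑ I ∈ G.indepSetsIn U with v ∈ I, lam ^ #I
        + ∑ I ∈ G.indepSetsIn U with (∀ w ∈ I, ¬G.Adj v w) ∧ v ∉ I, lam ^ #I := by
    rw [← sum_filter_add_sum_filter_not ((G.indepSetsIn U).filter fun I => ∀ w ∈ I, ¬G.Adj v w)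
      (fun I => v ∈ I), filter_filter, filter_filter]
    congr 2
    refine filter_congr fun I hI => ⟨fun h => h.2, fun h => ⟨?_, h⟩⟩
    exact (mem_indepSetsIn.mp hI).2 v h
  rw [h2, h1]
  ring

theorem sum_indepSetsIn_le_mul_sum_avoid (hlam : 0 < lam) (v : V) :
    ∑ I ∈ G.indepSetsIn U, lam ^ #I
      ≤ (1 + lam) ^ #(U.filter (G.Adj v)) *
          ∑ I ∈ G.indepSetsIn U with ∀ w ∈ I, ¬G.Adj v w, lam ^ #I := by
  have h := sum_indepSetsIn_eq (G := G) (lam := lam) (filter_subset (G.Adj v) U) (fun _ => 1)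
  simp only [mul_one] at h
  have h2 : G.indepSetsIn (U \ U.filter (G.Adj v))
      = (G.indepSetsIn U).filter fun I => ∀ w ∈ I, ¬G.Adj v w := by
    ext I
    rw [mem_filter, mem_indepSetsIn, mem_indepSetsIn]
    constructor
    · rintro ⟨h1, h2⟩
      exact ⟨⟨h1.trans sdiff_subset, h2⟩, fun w hw hvw => by have := h1 hw; simp_all⟩
    · rintro ⟨⟨h1, h2⟩, h3⟩
      refine ⟨fun w hw => ?_, h2⟩
      simpa using ⟨h1 hw, fun _ => h3 w hw⟩
  rw [h, h2, mul_sum]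
  refine sum_le_sum fun J _ => ?_
  rw [mul_comm]
  refine mul_le_mul_of_nonneg_right ?_ (by positivity)
  refine (sum_indepSetsIn_le hlam).trans ?_
  exact pow_le_pow_right₀ (by linarith) (card_le_card (filter_subset _ _))

theorem sum_card_mul_eq :
    ∑ I ∈ G.indepSetsIn U, lam ^ #I * (#I : ℝ)
      = ∑ v ∈ U, ∑ I ∈ G.indepSetsIn U with v ∈ I, lam ^ #I := by
  simp_rw [sum_filter]
  rw [sum_comm]
  refine sum_congr rfl fun I hI => ?_
  rw [← sum_filter, sum_const, filter_mem_eq_inter,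
    inter_eq_right.mpr (mem_indepSetsIn.mp hI).1, nsmul_eq_mul, mul_comm]

/-- A vertex of degree `d` in `U` is occupied with probability at least `lam (1+lam)^{-d-1}`;
convexity in `d` replaces the degrees by their average, at most `b`. -/
theorem card_mul_sum_le {b : ℝ} (hlam : 0 < lam)
    (hdeg : (∑ v ∈ U, (#(U.filter (G.Adj v)) : ℝ)) ≤ b * #U) :
    lam * (#U * ∑ I ∈ G.indepSetsIn U, lam ^ #I)
      ≤ (1 + lam) ^ b * ((1 + lam) * ∑ I ∈ G.indepSetsIn U, lam ^ #I * (#I : ℝ)) := by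
  set Z := ∑ I ∈ G.indepSetsIn U, lam ^ #I with hZ
  have hZ0 : 0 < Z := sum_indepSetsIn_pos hlam
  have h1 : 0 < 1 + lam := by linarith
  have hlog : 0 < Real.log (1 + lam) := Real.log_pos (by linarith)
  have hterm : ∀ v ∈ U, lam * Z * (1 - (#(U.filter (G.Adj v)) - b) * Real.log (1 + lam))
      ≤ (1 + lam) ^ b * ((1 + lam) * ∑ I ∈ G.indepSetsIn U with v ∈ I, lam ^ #I) := by
    intro v hv
    rw [one_add_mul_sum_mem hv]
    have h2 := sum_indepSetsIn_le_mul_sum_avoid (G := G) (U := U) hlam v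
    set d := #(U.filter (G.Adj v))
    set A := ∑ I ∈ G.indepSetsIn U with ∀ w ∈ I, ¬G.Adj v w, lam ^ #I
    -- Tangent line at `d = b`: after summation its linear term has the right sign by `hdeg`.
    have h3 : 1 - (d - b) * Real.log (1 + lam) ≤ (1 + lam) ^ (b - d) := by
      rw [Real.rpow_def_of_pos h1]
      linarith [Real.add_one_le_exp (Real.log (1 + lam) * (b - d))]
    calc lam * Z * (1 - (d - b) * Real.log (1 + lam))
        ≤ lam * Z * (1 + lam) ^ (b - d) := by gcongr
      _ ≤ lam * ((1 + lam) ^ d * A) * (1 + lam) ^ (b - d) := by gcongr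
      _ = lam * A * ((1 + lam) ^ (d : ℝ) * (1 + lam) ^ (b - d)) := by
          rw [Real.rpow_natCast]; ring
      _ = (1 + lam) ^ b * (lam * A) := by
          rw [← Real.rpow_add h1]; ring_nf
  have hsum := sum_le_sum hterm
  rw [← mul_sum, ← mul_sum, ← mul_sum, ← sum_card_mul_eq] at hsum
  refine le_trans ?_ hsum
  have h4 : lam * Z * ∑ v ∈ U, (1 - (#(U.filter (G.Adj v)) - b) * Real.log (1 + lam))
      = lam * Z * (#U + (b * #U - ∑ v ∈ U, (#(U.filter (G.Adj v)) : ℝ)) * Real.log (1 + lam)) := by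
    rw [sum_sub_distrib, ← sum_mul, sum_sub_distrib]
    simp only [sum_const, nsmul_eq_mul]
    ring
  rw [h4]
  have h5 : 0 ≤ lam * Z * ((b * #U - ∑ v ∈ U, (#(U.filter (G.Adj v)) : ℝ))
      * Real.log (1 + lam)) :=
    mul_nonneg (by positivity) (mul_nonneg (sub_nonneg.mpr hdeg) hlog.le)
  nlinarith

/-- Split `1 + W = t + (1 + W - t)` with `e^t = (1+lam)^#U`: the first part is paid by the expected
size, the second by `1 + W - t ≤ e^{W-t}` and `Z ≤ e^t`. -/
theorem one_add_mul_sum_le {b : ℝ} (hlam : 0 < lam) (W : ℝ)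
    (hdeg : (∑ v ∈ U, (#(U.filter (G.Adj v)) : ℝ)) ≤ b * #U) :
    (1 + W) * ∑ I ∈ G.indepSetsIn U, lam ^ #I
      ≤ Real.exp W + (1 + lam) ^ b * Real.log (1 + lam) * ((1 + lam) / lam) *
          ∑ I ∈ G.indepSetsIn U, lam ^ #I * (#I : ℝ) := by
  have h1 : 0 < 1 + lam := by linarith
  have hlog : 0 < Real.log (1 + lam) := Real.log_pos (by linarith)
  have hcard := card_mul_sum_le hlam hdeg
  have hZ0 := sum_indepSetsIn_pos (G := G) (U := U) hlam
  have hZ1 := sum_indepSetsIn_le (G := G) (U := U) hlam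
  set Z := ∑ I ∈ G.indepSetsIn U, lam ^ #I with hZ
  set E := ∑ I ∈ G.indepSetsIn U, lam ^ #I * (#I : ℝ)
  set t := #U * Real.log (1 + lam) with ht
  have hZt : Z ≤ Real.exp t := by
    rwa [ht, Real.exp_nat_mul, Real.exp_log h1]
  have h2 : t * Z ≤ (1 + lam) ^ b * Real.log (1 + lam) * ((1 + lam) / lam) * E := by
    have h3 : #U * Z ≤ (1 + lam) ^ b * ((1 + lam) * E) / lam := by
      rw [le_div_iff₀ hlam]; linarith
    calc t * Z = Real.log (1 + lam) * (#U * Z) := by rw [ht]; ring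
      _ ≤ Real.log (1 + lam) * ((1 + lam) ^ b * ((1 + lam) * E) / lam) := by gcongr
      _ = _ := by ring
  have h4 : (1 + W - t) * Z ≤ Real.exp W := by
    calc (1 + W - t) * Z ≤ Real.exp (W - t) * Z := by
          gcongr; linarith [Real.add_one_le_exp (W - t)]
      _ ≤ Real.exp (W - t) * Real.exp t := by gcongr
      _ = Real.exp W := by rw [← Real.exp_add]; ring_nf
  linarith

/-- Apply `one_add_mul_sum_le` to the unblocked neighbours for each configuration outside `N(u)`.
The term `T = ∅` is the event that `N(u)` is unoccupied, which converts to `u ∈ X`. -/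
theorem local_occupancy [Fintype V] {b : ℝ} (hlam : 0 < lam) (W : ℝ) (u : V)
    (hdeg : ∀ U ⊆ univ.filter (G.Adj u), (∑ v ∈ U, (#(U.filter (G.Adj v)) : ℝ)) ≤ b * #U) :
    (1 + W) * ∑ I ∈ G.indepSetsIn univ, lam ^ #I
      ≤ (1 + lam) / lam * (Real.exp W * ∑ I ∈ G.indepSetsIn univ with u ∈ I, lam ^ #I
          + (1 + lam) ^ b * Real.log (1 + lam) *
            ∑ v with G.Adj u v, ∑ I ∈ G.indepSetsIn univ with v ∈ I, lam ^ #I) := by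
  set S : Finset V := univ.filter (G.Adj u) with hS
  set C : ℝ := (1 + lam) ^ b * Real.log (1 + lam) * ((1 + lam) / lam) with hC
  have hneg : ∑ I ∈ G.indepSetsIn univ,
      lam ^ #I * ((1 + W) - Real.exp W * (if I ∩ S = ∅ then 1 else 0) - C * #(I ∩ S)) ≤ 0 := by
    rw [sum_indepSetsIn_eq (subset_univ S)
      (fun T => (1 + W) - Real.exp W * (if T = ∅ then 1 else 0) - C * #T)]
    refine sum_nonpos fun J _ => mul_nonpos_of_nonneg_of_nonpos (by positivity) ?_
    have h1 := one_add_mul_sum_le (b := b) hlam W (hdeg (G.unblocked S J) unblocked_subset)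
    have h2 : ∑ T ∈ G.indepSetsIn (G.unblocked S J), lam ^ #T * (if T = ∅ then (1 : ℝ) else 0)
        = 1 := by
      rw [sum_eq_single_of_mem ∅ empty_mem_indepSetsIn]
      · simp
      · intro T _ hT
        simp [hT]
    have h3 : ∑ T ∈ G.indepSetsIn (G.unblocked S J),
        lam ^ #T * ((1 + W) - Real.exp W * (if T = ∅ then 1 else 0) - C * #T)
        = (1 + W) * ∑ T ∈ G.indepSetsIn (G.unblocked S J), lam ^ #T
          - Real.exp W * ∑ T ∈ G.indepSetsIn (G.unblocked S J),
              lam ^ #T * (if T = ∅ then (1 : ℝ) else 0)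
          - C * ∑ T ∈ G.indepSetsIn (G.unblocked S J), lam ^ #T * (#T : ℝ) := by
      rw [mul_sum, mul_sum, mul_sum, ← sum_sub_distrib, ← sum_sub_distrib]
      exact sum_congr rfl fun T _ => by ring
    rw [h3, h2]
    linarith
  have h4 : ∑ I ∈ G.indepSetsIn univ, lam ^ #I * (if I ∩ S = ∅ then (1 : ℝ) else 0)
      = (1 + lam) / lam * ∑ I ∈ G.indepSetsIn univ with u ∈ I, lam ^ #I := by
    have h5 := one_add_mul_sum_mem (G := G) (lam := lam) (mem_univ u)
    rw [div_mul_eq_mul_div, h5, mul_div_cancel_left₀ _ hlam.ne', sum_filter]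
    refine sum_congr rfl fun I _ => ?_
    have : I ∩ S = ∅ ↔ ∀ w ∈ I, ¬G.Adj u w := by
      simp [hS, Finset.ext_iff]
    simp [this]
  have h6 : ∑ I ∈ G.indepSetsIn univ, lam ^ #I * (#(I ∩ S) : ℝ)
      = ∑ v ∈ S, ∑ I ∈ G.indepSetsIn univ with v ∈ I, lam ^ #I := by
    simp_rw [sum_filter]
    rw [sum_comm]
    refine sum_congr rfl fun I _ => ?_
    rw [← sum_filter, sum_const, filter_mem_eq_inter, inter_comm, nsmul_eq_mul, mul_comm]
  have h7 : ∑ I ∈ G.indepSetsIn univ,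
      lam ^ #I * ((1 + W) - Real.exp W * (if I ∩ S = ∅ then 1 else 0) - C * #(I ∩ S))
      = (1 + W) * ∑ I ∈ G.indepSetsIn univ, lam ^ #I
        - Real.exp W * ∑ I ∈ G.indepSetsIn univ, lam ^ #I * (if I ∩ S = ∅ then (1 : ℝ) else 0)
        - C * ∑ I ∈ G.indepSetsIn univ, lam ^ #I * (#(I ∩ S) : ℝ) := by
    rw [mul_sum, mul_sum, mul_sum, ← sum_sub_distrib, ← sum_sub_distrib]
    exact sum_congr rfl fun I _ => by ring
  rw [h7, h4, h6] at hneg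
  rw [hC] at hneg
  linarith

theorem hardCoreExpectation_card [Fintype V] :
    G.hardCoreExpectation (fun _ => lam) (fun I => (I.card : ℝ))
      = (∑ v, ∑ I ∈ G.indepSetsIn univ with v ∈ I, lam ^ #I)
        / ∑ I ∈ G.indepSetsIn univ, lam ^ #I := by
  have h : G.indepSets = G.indepSetsIn univ := by
    simp [indepSets, indepSetsIn]
  rw [← sum_card_mul_eq, sum_div]
  simp only [hardCoreExpectation, hardCorePr, partitionFunction, prod_const, h]
  exact sum_congr rfl fun I _ => by ring

theorem sum_card_filter_adj_le_of_maxAverageDegree_le [Fintype V] {b : ℝ} {u : V}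
    (hb : (G.induce (G.neighborSet u)).maxAverageDegree ≤ b) {U : Finset V}
    (hU : U ⊆ univ.filter (G.Adj u)) :
    (∑ v ∈ U, (#(U.filter (G.Adj v)) : ℝ)) ≤ b * #U := by
  rcases U.eq_empty_or_nonempty with rfl | hne
  · simp
  set H := G.induce (G.neighborSet u)
  have hUN : ∀ v ∈ U, v ∈ G.neighborSet u := fun v hv => (mem_filter.mp (hU hv)).2
  let s : Set (G.neighborSet u) := {x | (x : V) ∈ U}
  -- The full induced subgraph on `U` is the competitor in the supremum; the handshake lemma gives
  -- its degree sum.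
  let F : H.Subgraph := (⊤ : H.Subgraph).induce s
  have hF : F.verts = s := rfl
  have hsne : F.verts.Nonempty := by
    obtain ⟨v, hv⟩ := hne
    exact ⟨⟨v, hUN v hv⟩, hv⟩
  have hbdd : BddAbove {r : ℝ | ∃ F : H.Subgraph, F.verts.Nonempty ∧
      r = 2 * (F.edgeSet.ncard : ℝ) / (F.verts.ncard : ℝ)} := by
    refine ((Set.finite_range fun F : H.Subgraph =>
      2 * (F.edgeSet.ncard : ℝ) / (F.verts.ncard : ℝ)).subset ?_).bddAbove
    rintro r ⟨F, -, rfl⟩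
    exact ⟨F, rfl⟩
  have hle : 2 * (F.edgeSet.ncard : ℝ) / (F.verts.ncard : ℝ) ≤ b :=
    (le_csSup hbdd ⟨F, hsne, rfl⟩).trans hb
  have hs : F.verts.ncard = #U := by
    have : Subtype.val '' s = (U : Set V) := by
      ext v
      simp only [Set.mem_image, s, Set.mem_ofPred_eq, mem_coe]
      exact ⟨fun ⟨x, hx, hxv⟩ => hxv ▸ hx, fun hv => ⟨⟨v, hUN v hv⟩, hv, rfl⟩⟩
    rw [hF, ← Set.ncard_image_of_injective s Subtype.val_injective, this, Set.ncard_coe_finset]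
  have hsub : ∀ f : V → ℝ, ∑ v ∈ U, f v = ∑ x : G.neighborSet u, if (x : V) ∈ U then f x else 0 := by
    intro f
    rw [← sum_filter]
    refine sum_bij' (fun v hv => ⟨v, hUN v hv⟩) (fun x _ => (x : V)) ?_ ?_ ?_ ?_ ?_ <;>
      simp +contextual
  have he : 2 * (F.edgeSet.ncard : ℝ) = ∑ v ∈ U, (#(U.filter (G.Adj v)) : ℝ) := by
    have h1 := F.spanningCoe.sum_degrees_eq_twice_card_edges
    have h2 : F.edgeSet.ncard = #F.spanningCoe.edgeFinset := by
      rw [← Subgraph.edgeSet_spanningCoe, ← coe_edgeFinset, Set.ncard_coe_finset]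
    have h3 : 2 * (F.edgeSet.ncard : ℝ) = ∑ x, (F.spanningCoe.degree x : ℝ) := by
      rw [h2]; exact_mod_cast h1.symm
    rw [h3, hsub]
    refine sum_congr rfl fun x _ => ?_
    have h4 : (F.spanningCoe.degree x : ℝ)
        = ∑ y : G.neighborSet u, if F.spanningCoe.Adj x y then 1 else 0 := by
      rw [← card_neighborFinset_eq_degree, neighborFinset_eq_filter, card_filter]
      push_cast
      rfl
    have h5 : (#(U.filter (G.Adj x)) : ℝ) = ∑ v ∈ U, if G.Adj x v then 1 else 0 := by
      simp
    have h6 : ∀ y, F.spanningCoe.Adj x y ↔ (x : V) ∈ U ∧ (y : V) ∈ U ∧ G.Adj x y := by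
      intro y
      simp [F, s, H]
    rw [h4, h5, hsub]
    split_ifs with hx
    · refine sum_congr rfl fun y _ => ?_
      simp only [h6, hx, true_and]
      split_ifs <;> simp_all
    · exact sum_eq_zero fun y _ => if_neg fun h => hx ((h6 y).mp h).1
  have hpos : (0 : ℝ) < #U := by exact_mod_cast hne.card_pos
  rw [he, hs, div_le_iff₀ hpos] at hle
  exact hle

end HardCoreRestriction

end SimpleGraph

/-! ### Parameters and conclusion -/

theorem exp_neg_lambertW_eq {b lam : ℝ} {d : ℕ} (hlam : 0 < lam) (hd : 0 < d) :
    1 / (occBeta b lam d + d * occGamma b lam d)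
      = lam / (1 + lam) * Real.exp (-lambertW (occD b lam d)) := by
  have hd' : (0 : ℝ) < d := by exact_mod_cast hd
  have hD : 0 < occD b lam d :=
    mul_pos (mul_pos hd' (Real.rpow_pos_of_pos (by linarith) _)) (Real.log_pos (by linarith))
  obtain ⟨hW, hWD⟩ := lambertW_spec hD
  rw [occBeta, occGamma]
  set D := occD b lam d
  set W := lambertW D
  have hexp : 0 < Real.exp W := Real.exp_pos W
  have h1 : 1 + lam ≠ 0 := by linarith
  have h2 : 1 + W ≠ 0 := by linarith
  rw [Real.exp_neg, ← hWD]
  field_simp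

/-- Both constants meet the `1/8` threshold with room to spare: for `b ≥ 1`, `(1+lam)^b ≤ e^{cb} ≤
1.1`. -/
theorem mul_rpow_mul_log_le {b c lam Δ : ℝ} (hb : b = 0 ∨ 1 ≤ b)
    (hc0 : b = 0 → c = 0.109597) (hc1 : 1 ≤ b → c = 0.0896883 / b)
    (hΔ : 1 ≤ Δ) (hlam : 0 < lam) (hlt : lam < c / Δ) :
    Δ * (1 + lam) ^ b * Real.log (1 + lam) ≤ 1 / 8 := by
  have h1 : 0 < 1 + lam := by linarith
  have hΔlam : Δ * lam < c := by
    rw [lt_div_iff₀ (by linarith)] at hlt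
    linarith
  have hlog : Real.log (1 + lam) ≤ lam := by
    linarith [Real.log_le_sub_one_of_pos h1]
  have hmain : Δ * (1 + lam) ^ b * Real.log (1 + lam) ≤ c * (1 + lam) ^ b := by
    calc Δ * (1 + lam) ^ b * Real.log (1 + lam) ≤ Δ * (1 + lam) ^ b * lam := by gcongr
      _ = Δ * lam * (1 + lam) ^ b := by ring
      _ ≤ _ := by gcongr
  refine hmain.trans ?_
  rcases hb with rfl | hb
  · rw [hc0 rfl, Real.rpow_zero]
    norm_num
  · have hb0 : 0 < b := by linarith
    have hcb : c * b = 0.0896883 := by rw [hc1 hb]; field_simp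
    have hlamc : lam ≤ c := by nlinarith
    have hc : c ≤ 0.0896883 := by nlinarith
    have hpow : (1 + lam) ^ b ≤ Real.exp 0.0896883 := by
      rw [Real.rpow_def_of_pos h1, Real.exp_le_exp]
      nlinarith
    have hexp : Real.exp 0.0896883 ≤ 1.1 := by
      have h2 := Real.add_one_le_exp (-0.0896883)
      have h3 : Real.exp 0.0896883 * Real.exp (-0.0896883) = 1 := by rw [← Real.exp_add]; simp
      nlinarith [Real.exp_pos 0.0896883]
    calc c * (1 + lam) ^ b ≤ 0.0896883 * 1.1 := by
          gcongr
          exact hpow.trans hexp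
      _ ≤ 1 / 8 := by norm_num

open Finset in
theorem SimpleGraph.sum_exp_neg_lambertW_le {V : Type*} [Fintype V] (G : SimpleGraph V)
    [DecidableRel G.Adj] {b lam : ℝ} (hlam : 0 < lam) (hdeg : ∀ u, 0 < G.degree u)
    (hmad : ∀ u : V, (G.induce (G.neighborSet u)).maxAverageDegree ≤ b)
    (hsmall : ∀ u, occD b lam (G.degree u) ≤ 1 / 8) :
    ∑ u, lam / (1 + lam) * Real.exp (-lambertW (occD b lam (G.degree u)))
      ≤ G.hardCoreExpectation (fun _ => lam) (fun I => (I.card : ℝ)) := by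
  classical
  have h1 : 0 < 1 + lam := by linarith
  have hlog : 0 < Real.log (1 + lam) := Real.log_pos (by linarith)
  have hpow : 0 < (1 + lam) ^ b := Real.rpow_pos_of_pos h1 _
  set Λ : ℝ := (1 + lam) ^ b * Real.log (1 + lam) with hΛ
  have hΛ0 : 0 < Λ := mul_pos hpow hlog
  set W : V → ℝ := fun u => lambertW (occD b lam (G.degree u)) with hWdef
  have hW : ∀ u, 0 < W u ∧ W u * Real.exp (W u) = occD b lam (G.degree u) := fun u => by
    refine lambertW_spec ?_
    have : (0 : ℝ) < G.degree u := by exact_mod_cast hdeg u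
    exact mul_pos (mul_pos this hpow) hlog
  let a : V → V → ℝ := fun u v => if G.Adj u v then Λ else 0
  have hrow : ∀ u, ∑ v, a u v = occD b lam (G.degree u) := by
    intro u
    simp only [a, ← sum_filter, sum_const, nsmul_eq_mul]
    rw [← G.card_neighborFinset_eq_degree, G.neighborFinset_eq_filter, occD, hΛ, mul_assoc]
  set Z : ℝ := ∑ I ∈ G.indepSetsIn univ, lam ^ #I with hZ
  have hZ0 : 0 < Z := sum_indepSetsIn_pos hlam
  set P : V → ℝ := fun v => ∑ I ∈ G.indepSetsIn univ with v ∈ I, lam ^ #I with hP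
  have hE : G.hardCoreExpectation (fun _ => lam) (fun I => (I.card : ℝ)) = (∑ v, P v) / Z := by
    rw [hardCoreExpectation_card]
  have hloc : ∀ u, (1 + W u) * Z
      ≤ (1 + lam) / lam * (Real.exp (W u) * P u + Λ * ∑ v with G.Adj u v, P v) := by
    intro u
    have := local_occupancy (G := G) (b := b) hlam (W u) u
      (fun U hU => sum_card_filter_adj_le_of_maxAverageDegree_le (hmad u) hU)
    convert this
  have key := sum_exp_neg_le_sum (a := a) (W := W) (x := fun u => (1 + lam) / lam * P u / Z)
    (fun u v => by simp only [a]; split_ifs <;> [exact hΛ0.le; exact le_rfl])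
    (fun u v => by simp only [a, G.adj_comm u v])
    (fun u => (hW u).1.le) (fun u => by rw [hrow, (hW u).2])
    (fun u => by rw [hrow]; exact hsmall u) (fun u => by
      have h2 : ∑ v, a u v * ((1 + lam) / lam * P v / Z)
          = (1 + lam) / lam * (Λ * ∑ v with G.Adj u v, P v) / Z := by
        rw [sum_filter, mul_sum, mul_sum, sum_div]
        refine sum_congr rfl fun v _ => ?_
        simp only [a]
        split_ifs <;> ring
      rw [h2, ← mul_le_mul_iff_left₀ hZ0]
      refine (hloc u).trans (le_of_eq ?_)
      field_simp)
  rw [← mul_sum, hE]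
  calc lam / (1 + lam) * ∑ u, Real.exp (-W u)
      ≤ lam / (1 + lam) * ∑ u, (1 + lam) / lam * P u / Z := by gcongr
    _ = (∑ v, P v) / Z := by
      rw [← sum_div, ← mul_sum]
      field_simp

theorem theorem2 :
    ∃ c : ℝ → ℝ,
      (∀ b : ℝ, b = 0 ∨ 1 ≤ b →
        0 < c b ∧ c b < 1 ∧
        ∀ (V : Type*) [Fintype V] (G : SimpleGraph V) [DecidableRel G.Adj],
          (∀ u : V, 0 < G.degree u) →
          (∀ u : V, (G.induce (G.neighborSet u)).maxAverageDegree ≤ b) →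
          ∀ lam : ℝ, 0 < lam → lam < c b / (G.maxDegree : ℝ) →
            ∑ u : V, 1 / (occBeta b lam (G.degree u)
                + (G.degree u : ℝ) * occGamma b lam (G.degree u))
              ≤ G.hardCoreExpectation (fun _ => lam) (fun I => (I.card : ℝ))) ∧
      c 0 = 0.109597 ∧
      ∀ b : ℝ, 1 ≤ b → c b = 0.0896883 / b := by
  have hc1 : ∀ b : ℝ, 1 ≤ b → (if b = 0 then (0.109597 : ℝ) else 0.0896883 / b) = 0.0896883 / b :=
    fun b hb => if_neg (by linarith)
  refine ⟨fun b => if b = 0 then 0.109597 else 0.0896883 / b, ?_, if_pos rfl, hc1⟩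
  intro b hb
  have hcb : 0 < (if b = 0 then (0.109597 : ℝ) else 0.0896883 / b) ∧
      (if b = 0 then (0.109597 : ℝ) else 0.0896883 / b) < 1 := by
    rcases hb with rfl | hb
    · norm_num
    · rw [hc1 b hb, div_lt_one (by linarith)]
      exact ⟨div_pos (by norm_num) (by linarith), by linarith⟩
  refine ⟨hcb.1, hcb.2, ?_⟩
  intro V _ G _ hdeg hmad lam hlam hlt
  have hsmall : ∀ u, occD b lam (G.degree u) ≤ 1 / 8 := by
    intro u
    have hle : (G.degree u : ℝ) ≤ G.maxDegree := by exact_mod_cast G.degree_le_maxDegree u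
    have hone : (1 : ℝ) ≤ G.degree u := by exact_mod_cast hdeg u
    have hpow : 0 < (1 + lam) ^ b := Real.rpow_pos_of_pos (by linarith) _
    have hlog : 0 < Real.log (1 + lam) := Real.log_pos (by linarith)
    refine le_trans ?_ (mul_rpow_mul_log_le hb (fun h => if_pos h) (hc1 b) (hone.trans hle)
      hlam hlt)
    rw [occD]
    gcongr
  rw [Finset.sum_congr rfl fun u _ => exp_neg_lambertW_eq hlam (hdeg u)]
  exact G.sum_exp_neg_lambertW_le hlam hdeg hmad hsmall
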